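/- Let $\alpha,\beta,\gamma\in\{1,2,\infty\}$, $\mu_1,\mu_2,\rho\ge 0$, $b\in\mathbb R^q$, $d\in\mathbb R^p$, and let $\mathcal A:\mathbb R^{m\times n}\to\mathbb R^q$ and $\mathcal C:\mathbb R^{m\times n}\to\mathbb R^p$ be linear, with $\mathcal A$ of full row rank (i.e. surjective). Consider the composite norm minimization problem $$(\ast)\qquad \min_{X\in\mathbb R^{m\times n}}\ \mu_1\|\sigma(X)\|_\alpha+\mu_2\|\mathcal C(X)-d\|_\beta\quad\text{subject to}\quad \|\mathcal A(X)-b\|_\gamma\le\rho,$$ where $\sigma(X)\in\mathbb R^{\min\{m,n\}}$ is the vector of singular values of $X$. Let $\lambda^{(k)}>0$, $\epsilon^{(k)}$, $\tau^{(k)}$, $\xi^{(k)}$ ($k\ge 1$) be real parameters. A run of the first-order augmented Lagrangian algorithm (FALC) starts from some $X^{(0)}\in\mathbb R^{m\times n}$, puts $\eta=\mu_1\|\sigma(X^{(0)})\|_\alpha+\mu_2\|\mathcal C(X^{(0)})-d\|_\beta$, $\theta_1^{(1)}=0$, $\theta_2^{(1)}=0$, and for $k=1,2,\dots$, with $$P^{(k)}(X,s,y)=\lambda^{(k)}\big(\mu_1\|\sigma(X)\|_\alpha+\mu_2\|s\|_\beta\big)+\tfrac12\|\mathcal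 A(X)+y-b-\lambda^{(k)}\theta_1^{(k)}\|_2^2+\tfrac12\|\mathcal C(X)+s-d-\lambda^{(k)}\theta_2^{(k)}\|_2^2,$$ computes a triple $(X^{(k)},s^{(k)},y^{(k)})\in\mathbb R^{m\times n}\times\mathbb R^p\times\mathbb R^q$ with $\|y^{(k)}\|_\gamma\le\rho$ that satisfies at least one of the following: (a) $P^{(k)}(X^{(k)},s^{(k)},y^{(k)})\le\inf\{P^{(k)}(X,s,y): X\in\mathbb R^{m\times n},\ s\in\mathbb R^p,\ \|y\|_\gamma\le\rho\}+\epsilon^{(k)}$; (b) there is a partial subgradient $(G,g)\in\partial_{X,s}P^{(k)}$ at $(X^{(k)},s^{(k)},y^{(k)})$ with $\sqrt{\|G\|_F^2+\|g\|_2^2}\le\tau^{(k)}$; moreover, with $v=\nabla_yP^{(k)}(X^{(k)},s^{(k)},y^{(k)})$ and $\|\cdot\|_{\gamma^*}$ the dual norm of $\|\cdot\|_\gamma$, $\rho\|v\|_{\gamma^*}+v^Ty^{(k)}\le\xi^{(k)}$; and $\mu_1\|\sigma(X^{(k)})\|_\alpha\le\eta+\frac{\lambda^{(k)}}2\big(\|\theta_1^{(k)}\|_2^2+\|\theta_2^{(k)}\|_2^2\big)$;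 it then updates $\theta_1^{(k+1)}=\theta_1^{(k)}-\frac{\mathcal A(X^{(k)})+y^{(k)}-b}{\lambda^{(k)}}$ and $\theta_2^{(k+1)}=\theta_2^{(k)}-\frac{\mathcal C(X^{(k)})+s^{(k)}-d}{\lambda^{(k)}}$. Suppose that, as $k\to\infty$, each of $\lambda^{(k)},\epsilon^{(k)},\tau^{(k)},\xi^{(k)}$ decreases monotonically to $0$, that $\epsilon^{(k)}/(\lambda^{(k)})^2\le B$ for all $k\ge1$ and some $B>0$, and that $\tau^{(k)}/\lambda^{(k)}\to0$ and $\xi^{(k)}/\lambda^{(k)}\to0$. Then for every such run: 1. if $\mu_1>0$, or if $\mu_2>0$ and $\mathcal C$ is injective, then $(X^{(k)})_{k\ge 0}$ is a bounded sequence; 2. every limit point of $(X^{(k)})$ (the limit of a convergent subsequence) is an optimal solution of $(\ast)$. -/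

import Mathlib

open Set Filter Topology
open scoped ENNReal

noncomputable section

/-- The `ℓ_r` norm of a vector (used with `r ∈ {1, 2, ∞}`). -/
def lrNorm {k : ℕ} (r : ℝ≥0∞) (x : EuclideanSpace ℝ (Fin k)) : ℝ :=
  ‖WithLp.toLp r (fun i => x i)‖

/-- The dual norm of the `ℓ_r` norm with respect to the Euclidean inner product. -/
def dualNorm {k : ℕ} (r : ℝ≥0∞) (v : EuclideanSpace ℝ (Fin k)) : ℝ :=
  sSup {t : ℝ | ∃ w : EuclideanSpace ℝ (Fin k), lrNorm r w ≤ 1 ∧ t = inner ℝ w v}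

/-- The vector of singular values of an `m × n` matrix, in `ℝ^{min{m,n}}`. -/
def singularVector {m n : ℕ} (X : Matrix (Fin m) (Fin n) ℝ) :
    EuclideanSpace ℝ (Fin (min m n)) :=
  WithLp.toLp 2 (fun i => (Matrix.toEuclideanLin X).singularValues i)

/-- The trace inner product of two matrices. -/
def frobInner {m n : ℕ} (X Y : Matrix (Fin m) (Fin n) ℝ) : ℝ :=
  (X.transpose * Y).trace

/-- The Frobenius norm of a matrix. -/
def frobNorm {m n : ℕ} (X : Matrix (Fin m) (Fin n) ℝ) : ℝ :=
  Real.sqrt (frobInner X X)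

/-- The data of the problem
`min μ₁ ‖σ(X)‖_α + μ₂ ‖C(X) - d‖_β` subject to `‖A(X) - b‖_γ ≤ ρ`. -/
structure CompositeProblem (m n p q : ℕ) where
  α : ℝ≥0∞
  β : ℝ≥0∞
  γ : ℝ≥0∞
  μ₁ : ℝ
  μ₂ : ℝ
  ρ : ℝ
  A : Matrix (Fin m) (Fin n) ℝ →ₗ[ℝ] EuclideanSpace ℝ (Fin q)
  b : EuclideanSpace ℝ (Fin q)
  C : Matrix (Fin m) (Fin n) ℝ →ₗ[ℝ] EuclideanSpace ℝ (Fin p)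
  d : EuclideanSpace ℝ (Fin p)

namespace CompositeProblem

variable {m n p q : ℕ} (D : CompositeProblem m n p q)

/-- The objective function. -/
def objective (X : Matrix (Fin m) (Fin n) ℝ) : ℝ :=
  D.μ₁ * lrNorm D.α (singularVector X) + D.μ₂ * lrNorm D.β (D.C X - D.d)

/-- The feasible set. -/
def feasible : Set (Matrix (Fin m) (Fin n) ℝ) :=
  {X | lrNorm D.γ (D.A X - D.b) ≤ D.ρ}

/-- `X` is an optimal solution. -/
def IsOptimal (X : Matrix (Fin m) (Fin n) ℝ) : Prop :=
  X ∈ D.feasible ∧ ∀ Y ∈ D.feasible, D.objective X ≤ D.objective Y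

/-- The smooth part `f` of the augmented Lagrangian subproblem with penalty parameter `l` and
multipliers `θ₁`, `θ₂`. -/
def smoothPart (l : ℝ) (θ₁ : EuclideanSpace ℝ (Fin q)) (θ₂ : EuclideanSpace ℝ (Fin p))
    (X : Matrix (Fin m) (Fin n) ℝ) (s : EuclideanSpace ℝ (Fin p))
    (y : EuclideanSpace ℝ (Fin q)) : ℝ :=
  1 / 2 * ‖D.A X + y - D.b - l • θ₁‖ ^ 2 + 1 / 2 * ‖D.C X + s - D.d - l • θ₂‖ ^ 2

/-- The objective `P` of the augmented Lagrangian subproblem. -/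
def penalized (l : ℝ) (θ₁ : EuclideanSpace ℝ (Fin q)) (θ₂ : EuclideanSpace ℝ (Fin p))
    (X : Matrix (Fin m) (Fin n) ℝ) (s : EuclideanSpace ℝ (Fin p))
    (y : EuclideanSpace ℝ (Fin q)) : ℝ :=
  l * (D.μ₁ * lrNorm D.α (singularVector X) + D.μ₂ * lrNorm D.β s)
    + D.smoothPart l θ₁ θ₂ X s y

/-- The set of values of `P` on the feasible set `{(X, s, y) : ‖y‖_γ ≤ ρ}` of the subproblem. -/
def penalizedValues (l : ℝ) (θ₁ : EuclideanSpace ℝ (Fin q)) (θ₂ : EuclideanSpace ℝ (Fin p)) :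
    Set ℝ :=
  {t | ∃ (X : Matrix (Fin m) (Fin n) ℝ) (s : EuclideanSpace ℝ (Fin p))
    (y : EuclideanSpace ℝ (Fin q)), lrNorm D.γ y ≤ D.ρ ∧ t = D.penalized l θ₁ θ₂ X s y}

/-- The partial gradient of `P` with respect to `y`. -/
def gradY (l : ℝ) (θ₁ : EuclideanSpace ℝ (Fin q)) (θ₂ : EuclideanSpace ℝ (Fin p))
    (X : Matrix (Fin m) (Fin n) ℝ) (s : EuclideanSpace ℝ (Fin p))
    (y : EuclideanSpace ℝ (Fin q)) : EuclideanSpace ℝ (Fin q) :=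
  gradient (fun y' => D.penalized l θ₁ θ₂ X s y') y

/-- The set of partial subgradients of `P` at `(X, s, y)` with respect to `(X, s)`. -/
def partialSubdiff (l : ℝ) (θ₁ : EuclideanSpace ℝ (Fin q)) (θ₂ : EuclideanSpace ℝ (Fin p))
    (X : Matrix (Fin m) (Fin n) ℝ) (s : EuclideanSpace ℝ (Fin p))
    (y : EuclideanSpace ℝ (Fin q)) :
    Set (Matrix (Fin m) (Fin n) ℝ × EuclideanSpace ℝ (Fin p)) :=
  {G | ∀ (X' : Matrix (Fin m) (Fin n) ℝ) (s' : EuclideanSpace ℝ (Fin p)),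
    D.penalized l θ₁ θ₂ X s y + frobInner G.1 (X' - X) + inner ℝ G.2 (s' - s)
      ≤ D.penalized l θ₁ θ₂ X' s' y}

/-- The first inner stopping condition: `ε`-optimality for the subproblem. -/
def StopA (l ε : ℝ) (θ₁ : EuclideanSpace ℝ (Fin q)) (θ₂ : EuclideanSpace ℝ (Fin p))
    (X : Matrix (Fin m) (Fin n) ℝ) (s : EuclideanSpace ℝ (Fin p))
    (y : EuclideanSpace ℝ (Fin q)) : Prop :=
  D.penalized l θ₁ θ₂ X s y ≤ sInf (D.penalizedValues l θ₁ θ₂) + ε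

/-- The second inner stopping condition, where `ηk` is the current bound on `μ₁ ‖σ(X)‖_α`. -/
def StopB (l τ ξ ηk : ℝ) (θ₁ : EuclideanSpace ℝ (Fin q)) (θ₂ : EuclideanSpace ℝ (Fin p))
    (X : Matrix (Fin m) (Fin n) ℝ) (s : EuclideanSpace ℝ (Fin p))
    (y : EuclideanSpace ℝ (Fin q)) : Prop :=
  (∃ G ∈ D.partialSubdiff l θ₁ θ₂ X s y, Real.sqrt (frobNorm G.1 ^ 2 + ‖G.2‖ ^ 2) ≤ τ) ∧
  D.ρ * dualNorm D.γ (D.gradY l θ₁ θ₂ X s y) + inner ℝ (D.gradY l θ₁ θ₂ X s y) y ≤ ξ ∧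
  D.μ₁ * lrNorm D.α (singularVector X) ≤ ηk

/-- The sequences `X, s, y` (with index `0` the starting point) and `θ₁, θ₂` (indices `k ≥ 1`) are
generated by FALC with parameters `lam, ε, τ, ξ` (indices `k ≥ 1`). -/
structure IsFALC (lam ε τ ξ : ℕ → ℝ) (X : ℕ → Matrix (Fin m) (Fin n) ℝ)
    (s : ℕ → EuclideanSpace ℝ (Fin p)) (y : ℕ → EuclideanSpace ℝ (Fin q))
    (θ₁ : ℕ → EuclideanSpace ℝ (Fin q)) (θ₂ : ℕ → EuclideanSpace ℝ (Fin p)) : Prop where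
  theta₁_one : θ₁ 1 = 0
  theta₂_one : θ₂ 1 = 0
  y_mem : ∀ k, 1 ≤ k → lrNorm D.γ (y k) ≤ D.ρ
  accept : ∀ k, 1 ≤ k →
    D.StopA (lam k) (ε k) (θ₁ k) (θ₂ k) (X k) (s k) (y k) ∨
    D.StopB (lam k) (τ k) (ξ k)
      (D.objective (X 0) + lam k / 2 * (‖θ₁ k‖ ^ 2 + ‖θ₂ k‖ ^ 2))
      (θ₁ k) (θ₂ k) (X k) (s k) (y k)
  theta₁_succ : ∀ k, 1 ≤ k →
    θ₁ (k + 1) = θ₁ k - (lam k)⁻¹ • (D.A (X k) + y k - D.b)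
  theta₂_succ : ∀ k, 1 ≤ k →
    θ₂ (k + 1) = θ₂ k - (lam k)⁻¹ • (D.C (X k) + s k - D.d)

end CompositeProblem

/-- The sequence `u 1, u 2, …` decreases monotonically to `0`. -/
def DecreasesToZero (u : ℕ → ℝ) : Prop :=
  AntitoneOn u (Ici 1) ∧ Tendsto u atTop (𝓝 0)

end

/-!
The pair `v = (X, s)` minimizes a function `f` subject to `c - T v ∈ Q`, where `T` is a surjective
linear map and `f` is a seminorm. That `f` is a seminorm rests on the triangle inequality for
Schatten norms: pairing `X` with Bessel families of vectors expresses the result through the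
singular values of `X` by a doubly substochastic matrix, which does not increase any `ℓ_r` norm.

Since `T` is surjective with bounded preimages and `f` is Lipschitz, comparing an iterate with a
nearby point at which the shifted residual vanishes shows that this residual is `O(λ)`. The
multipliers are the shifted residuals divided by `λ`, hence bounded, and so the constraint residuals
tend to zero. Testing either stopping rule against a feasible `v'` then yields
`f (v k) ≤ f v' + δ k * (1 + ‖v' - v k‖)` with `δ k → 0`. When `f + ‖T ·‖` is a norm this bounds the
iterates, because `δ k * ‖v k‖` can be absorbed on the left; along a convergent subsequence it gives
optimality of the limit.
-/

open scoped NNReal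

section FiniteDimensionalSeminorm

variable {E : Type*} [NormedAddCommGroup E] [NormedSpace ℝ E] [FiniteDimensional ℝ E]

theorem continuous_seminorm (N : Seminorm ℝ E) : Continuous N :=
  continuousOn_univ.1 (N.convexOn.continuousOn isOpen_univ)

theorem exists_lipschitzWith_seminorm (N : Seminorm ℝ E) : ∃ L : ℝ≥0, LipschitzWith L N := by
  obtain ⟨L, -, hL⟩ := N.bound_of_continuous_normedSpace (continuous_seminorm N)
  refine ⟨L.toNNReal, LipschitzWith.of_dist_le' fun x y => ?_⟩
  rw [Real.dist_eq, dist_eq_norm]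
  exact (abs_sub_map_le_sub N x y).trans (hL _)

theorem exists_norm_le_mul_seminorm (N : Seminorm ℝ E) (hN : ∀ x, N x = 0 → x = 0) :
    ∃ K : ℝ, 0 ≤ K ∧ ∀ x, ‖x‖ ≤ K * N x := by
  obtain ⟨c, hc, hcN⟩ := (isCompact_sphere (0 : E) 1).exists_forall_le' (a := 0)
    (continuous_seminorm N).continuousOn fun x hx =>
      (apply_nonneg N x).lt_of_ne' (mt (hN x) (ne_zero_of_mem_unit_sphere ⟨x, hx⟩))
  refine ⟨c⁻¹, inv_nonneg.2 hc.le, fun x => ?_⟩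
  rcases eq_or_ne x 0 with rfl | hx
  · simp
  · have hunit : ‖x‖⁻¹ • x ∈ Metric.sphere (0 : E) 1 := by simp [norm_smul, hx]
    have h := hcN _ hunit
    rw [map_smul_eq_mul, norm_inv, norm_norm, ← div_eq_inv_mul, le_div_iff₀ (norm_pos_iff.2 hx)]
      at h
    rwa [← div_eq_inv_mul, le_div_iff₀' hc]

end FiniteDimensionalSeminorm

section LrNorm

variable {k : ℕ} (r : ℝ≥0∞) [Fact (1 ≤ r)]

/-- The `ℓ_r` norm as a seminorm on Euclidean space. -/
noncomputable def lrSeminorm (k : ℕ) (r : ℝ≥0∞) [Fact (1 ≤ r)] :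
    Seminorm ℝ (EuclideanSpace ℝ (Fin k)) :=
  Seminorm.of (lrNorm r)
    (fun x y => norm_add_le (WithLp.toLp r fun i => x i) (WithLp.toLp r fun i => y i))
    (fun a x => norm_smul a (WithLp.toLp r fun i => x i))

theorem coe_lrSeminorm : ⇑(lrSeminorm k r) = lrNorm r := rfl

theorem lrNorm_nonneg (x : EuclideanSpace ℝ (Fin k)) : 0 ≤ lrNorm r x :=
  apply_nonneg (lrSeminorm k r) x

theorem lrNorm_sub_comm (x y : EuclideanSpace ℝ (Fin k)) : lrNorm r (x - y) = lrNorm r (y - x) :=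
  map_sub_rev (lrSeminorm k r) x y

variable {r}

theorem lrNorm_eq_zero_iff {x : EuclideanSpace ℝ (Fin k)} : lrNorm r x = 0 ↔ x = 0 := by
  rw [lrNorm, norm_eq_zero, WithLp.toLp_eq_zero, WithLp.ext_iff]
  rfl

theorem lrNorm_eq_sum (hr : r ≠ ∞) (x : EuclideanSpace ℝ (Fin k)) :
    lrNorm r x = (∑ i, |x i| ^ r.toReal) ^ (1 / r.toReal) :=
  PiLp.norm_eq_sum (ENNReal.toReal_pos (one_pos.trans_le Fact.out).ne' hr) _

theorem abs_apply_le_lrNorm (x : EuclideanSpace ℝ (Fin k)) (i : Fin k) : |x i| ≤ lrNorm r x :=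
  PiLp.norm_apply_le (WithLp.toLp r fun i => x i) i

theorem isBounded_lrNorm_le (ρ : ℝ) :
    Bornology.IsBounded {y : EuclideanSpace ℝ (Fin k) | lrNorm r y ≤ ρ} := by
  obtain ⟨K, hK0, hK⟩ := exists_norm_le_mul_seminorm (lrSeminorm k r)
    fun x => lrNorm_eq_zero_iff.1
  exact isBounded_iff_forall_norm_le.2
    ⟨K * ρ, fun y hy => (hK y).trans (mul_le_mul_of_nonneg_left hy hK0)⟩

theorem isClosed_lrNorm_le (ρ : ℝ) :
    IsClosed {y : EuclideanSpace ℝ (Fin k) | lrNorm r y ≤ ρ} :=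
  isClosed_le (continuous_seminorm (lrSeminorm k r)) continuous_const

theorem inner_le_dualNorm {v w : EuclideanSpace ℝ (Fin k)} (hw : lrNorm r w ≤ 1) :
    inner ℝ w v ≤ dualNorm r v := by
  obtain ⟨M, hM⟩ := (isBounded_lrNorm_le (k := k) (r := r) 1).exists_norm_le
  refine le_csSup ⟨M * ‖v‖, ?_⟩ ⟨w, hw, rfl⟩
  rintro _ ⟨u, hu, rfl⟩
  exact (real_inner_le_norm u v).trans (by gcongr; exact hM u hu)

theorem inner_le_lrNorm_mul_dualNorm (w v : EuclideanSpace ℝ (Fin k)) :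
    inner ℝ w v ≤ lrNorm r w * dualNorm r v := by
  rcases eq_or_ne w 0 with rfl | hw
  · simp [lrNorm_eq_zero_iff.2 rfl]
  · have hpos : 0 < lrNorm r w := (lrNorm_nonneg r w).lt_of_ne' (mt lrNorm_eq_zero_iff.1 hw)
    have hunit : lrNorm r ((lrNorm r w)⁻¹ • w) = 1 := by
      rw [← coe_lrSeminorm, map_smul_eq_mul, norm_inv, coe_lrSeminorm,
        Real.norm_of_nonneg hpos.le, inv_mul_cancel₀ hpos.ne']
    have h := inner_le_dualNorm (v := v) hunit.le
    rwa [real_inner_smul_left, ← div_eq_inv_mul, div_le_iff₀' hpos] at h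

theorem dualNorm_nonneg (v : EuclideanSpace ℝ (Fin k)) : 0 ≤ dualNorm r v := by
  simpa using inner_le_dualNorm (r := r) (v := v) (w := 0) (by simp [lrNorm_eq_zero_iff.2 rfl])

theorem inner_sub_le_of_mul_dualNorm_add_inner_le {ρ ξ : ℝ} {v y y' : EuclideanSpace ℝ (Fin k)}
    (h : ρ * dualNorm r v + inner ℝ v y ≤ ξ) (hy' : lrNorm r y' ≤ ρ) :
    inner ℝ v (y - y') ≤ ξ := by
  have hdual := inner_le_lrNorm_mul_dualNorm (r := r) (-y') v
  rw [← coe_lrSeminorm, map_neg_eq_map, coe_lrSeminorm, inner_neg_left, real_inner_comm] at hdual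
  rw [inner_sub_right]
  linarith [mul_le_mul_of_nonneg_right hy' (dualNorm_nonneg (r := r) v)]

theorem rpow_sum_mul_le_sum_mul_rpow {ι : Type*} {s : Finset ι} {w f : ι → ℝ} {p : ℝ}
    (hp : 1 ≤ p) (hw : ∀ i, 0 ≤ w i) (hf : ∀ i, 0 ≤ f i) (hsum : ∑ i ∈ s, w i ≤ 1) :
    (∑ i ∈ s, w i * f i) ^ p ≤ ∑ i ∈ s, w i * f i ^ p := by
  have hS : 0 ≤ ∑ i ∈ s, w i * f i ^ p :=
    Finset.sum_nonneg fun i _ => mul_nonneg (hw i) (Real.rpow_nonneg (hf i) p)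
  have hW : 0 ≤ ∑ i ∈ s, w i := Finset.sum_nonneg fun i _ => hw i
  calc (∑ i ∈ s, w i * f i) ^ p
      ≤ ((∑ i ∈ s, w i) ^ (1 - p⁻¹) * (∑ i ∈ s, w i * f i ^ p) ^ p⁻¹) ^ p := by
        gcongr
        · exact Finset.sum_nonneg fun i _ => mul_nonneg (hw i) (hf i)
        · exact Real.inner_le_weight_mul_Lp_of_nonneg s hp w f hw hf
    _ ≤ (1 * (∑ i ∈ s, w i * f i ^ p) ^ p⁻¹) ^ p := by
        gcongr
        exact Real.rpow_le_one hW hsum (sub_nonneg.2 (inv_le_one_of_one_le₀ hp))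
    _ = ∑ i ∈ s, w i * f i ^ p := by
        rw [one_mul, Real.rpow_inv_rpow hS (one_pos.trans_le hp).ne']

theorem lrNorm_le_of_doubly_substochastic {l : ℕ} {x : EuclideanSpace ℝ (Fin k)}
    {z : EuclideanSpace ℝ (Fin l)} {Q : Fin l → Fin k → ℝ} (hQ : ∀ i j, 0 ≤ Q i j)
    (hrow : ∀ i, ∑ j, Q i j ≤ 1) (hcol : ∀ j, ∑ i, Q i j ≤ 1)
    (h : ∀ i, |z i| ≤ ∑ j, Q i j * |x j|) : lrNorm r z ≤ lrNorm r x := by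
  rcases eq_or_ne r ∞ with rfl | hr
  · rw [lrNorm, PiLp.norm_toLp, pi_norm_le_iff_of_nonneg (lrNorm_nonneg ∞ x)]
    refine fun i => (h i).trans ?_
    calc ∑ j, Q i j * |x j| ≤ ∑ j, Q i j * lrNorm ∞ x := by
          gcongr with j
          · exact hQ i j
          · exact abs_apply_le_lrNorm x j
      _ = (∑ j, Q i j) * lrNorm ∞ x := (Finset.sum_mul ..).symm
      _ ≤ lrNorm ∞ x := mul_le_of_le_one_left (lrNorm_nonneg ∞ x) (hrow i)
  · have hp : 1 ≤ r.toReal := ENNReal.toReal_mono hr (Fact.out : 1 ≤ r)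
    rw [lrNorm_eq_sum hr, lrNorm_eq_sum hr]
    gcongr
    calc ∑ i, |z i| ^ r.toReal
        ≤ ∑ i, (∑ j, Q i j * |x j|) ^ r.toReal := by gcongr with i; exact h i
      _ ≤ ∑ i, ∑ j, Q i j * |x j| ^ r.toReal := by
          gcongr with i
          exact rpow_sum_mul_le_sum_mul_rpow hp (hQ i) (fun j => abs_nonneg (x j)) (hrow i)
      _ = ∑ j, (∑ i, Q i j) * |x j| ^ r.toReal := by
          rw [Finset.sum_comm]
          simp only [Finset.sum_mul]
      _ ≤ ∑ j, |x j| ^ r.toReal := by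
          gcongr with j
          exact mul_le_of_le_one_left (by positivity) (hcol j)

end LrNorm

section Bessel

variable {ι κ V W : Type*} [Fintype ι] [NormedAddCommGroup V] [InnerProductSpace ℝ V]
  [NormedAddCommGroup W] [InnerProductSpace ℝ W]

/-- A finite family satisfying Bessel's inequality. Singular vectors are only required to form such
families, so that the left singular vectors of vanishing singular values can be taken to be zero. -/
def IsBessel (u : ι → V) : Prop := ∀ x, ∑ i, (inner ℝ (u i) x) ^ 2 ≤ ‖x‖ ^ 2

theorem isBessel_of_orthonormal {u : ι → V} (hu : Orthonormal ℝ u) : IsBessel u := fun x => by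
  simpa using hu.sum_inner_products_le x (s := Finset.univ)

theorem isBessel_of_inner_eq [DecidableEq ι] {u : ι → V} {w : ι → ℝ} (hw : ∀ i, w i ≤ 1)
    (hu : ∀ i j, inner ℝ (u i) (u j) = if i = j then w i else 0) : IsBessel u := by
  intro x
  set z := ∑ i, (inner ℝ (u i) x) • u i with hz
  have hxz : inner ℝ x z = ∑ i, (inner ℝ (u i) x) ^ 2 := by
    simp only [hz, inner_sum, inner_smul_right, real_inner_comm (u _) x, pow_two]
  have hzz : ‖z‖ ^ 2 ≤ ∑ i, (inner ℝ (u i) x) ^ 2 := by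
    rw [← real_inner_self_eq_norm_sq]
    simp only [hz, inner_sum, sum_inner, inner_smul_right, real_inner_smul_left, hu, mul_ite,
      mul_zero, Finset.sum_ite_eq', Finset.mem_univ, if_true]
    gcongr with i
    nlinarith [hw i, sq_nonneg (inner ℝ (u i) x)]
  linarith [norm_sub_sq_real x z, sq_nonneg ‖x - z‖]

namespace IsBessel

variable {u : ι → V} {v : ι → W}

theorem comp_injective [Fintype κ] (hu : IsBessel u) {g : κ → ι} (hg : Function.Injective g) :
    IsBessel (u ∘ g) := fun x => by
  classical
  calc ∑ i, (inner ℝ (u (g i)) x) ^ 2 = ∑ j ∈ Finset.univ.image g, (inner ℝ (u j) x) ^ 2 :=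
        (Finset.sum_image (f := fun j => (inner ℝ (u j) x) ^ 2) hg.injOn).symm
    _ ≤ ∑ j, (inner ℝ (u j) x) ^ 2 :=
        Finset.sum_le_univ_sum_of_nonneg fun j => sq_nonneg _
    _ ≤ ‖x‖ ^ 2 := hu x

theorem norm_le_one (hu : IsBessel u) (i : ι) : ‖u i‖ ≤ 1 := by
  have h : (inner ℝ (u i) (u i)) ^ 2 ≤ ‖u i‖ ^ 2 :=
    (Finset.single_le_sum (f := fun j => (inner ℝ (u j) (u i)) ^ 2)
      (fun j _ => sq_nonneg _) (Finset.mem_univ i)).trans (hu (u i))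
  rw [real_inner_self_eq_norm_sq] at h
  by_contra! hlt
  nlinarith [one_lt_pow₀ hlt two_ne_zero]

theorem sum_abs_mul_abs_le (hu : IsBessel u) (hv : IsBessel v) (x : V) (y : W) :
    ∑ i, |inner ℝ (u i) x| * |inner ℝ (v i) y| ≤ ‖x‖ * ‖y‖ := by
  refine abs_le_of_sq_le_sq' ?_ (by positivity) |>.2
  calc (∑ i, |inner ℝ (u i) x| * |inner ℝ (v i) y|) ^ 2
      ≤ (∑ i, |inner ℝ (u i) x| ^ 2) * ∑ i, |inner ℝ (v i) y| ^ 2 :=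
        Finset.sum_mul_sq_le_sq_mul_sq _ _ _
    _ ≤ ‖x‖ ^ 2 * ‖y‖ ^ 2 := by
        simp only [sq_abs]
        gcongr
        exacts [hu x, hv y]
    _ = (‖x‖ * ‖y‖) ^ 2 := (mul_pow ..).symm

end IsBessel

end Bessel

section SingularValueDecomposition

variable {E F : Type*} [NormedAddCommGroup E] [InnerProductSpace ℝ E]
  [NormedAddCommGroup F] [InnerProductSpace ℝ F]

/-- The families `u` and `v` of left and right singular vectors, together with the values `σ`, form
a (thin) singular value decomposition of `T`. -/
structure IsSingularValueDecomposition {ι : Type*} [Fintype ι] (T : E →ₗ[ℝ] F) (σ : ι → ℝ)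
    (u : ι → F) (v : ι → E) : Prop where
  left : IsBessel u
  right : IsBessel v
  apply_eq_sum : ∀ x, T x = ∑ i, (σ i * inner ℝ (v i) x) • u i
  inner_apply : ∀ i, inner ℝ (u i) (T (v i)) = σ i

variable [FiniteDimensional ℝ E] [FiniteDimensional ℝ F] (T : E →ₗ[ℝ] F) {n : ℕ}
  (hn : Module.finrank ℝ E = n)

/-- An orthonormal basis of eigenvectors of `T† T`, which serve as right singular vectors. -/
noncomputable def rightSingularBasis : OrthonormalBasis (Fin n) ℝ E :=
  T.isSymmetric_adjoint_comp_self.eigenvectorBasis hn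

/-- The left singular vectors of `T`; those of vanishing singular values are zero since
`0⁻¹ = 0`. -/
noncomputable def leftSingularVector (i : Fin n) : F :=
  (T.singularValues i)⁻¹ • T (rightSingularBasis T hn i)

theorem inner_apply_rightSingularBasis (i j : Fin n) :
    inner ℝ (T (rightSingularBasis T hn i)) (T (rightSingularBasis T hn j)) =
      if i = j then T.singularValues i ^ 2 else 0 := by
  rw [T.sq_singularValues_fin hn, ← LinearMap.adjoint_inner_left, ← LinearMap.comp_apply,
    rightSingularBasis, T.isSymmetric_adjoint_comp_self.apply_eigenvectorBasis hn i,
    inner_smul_left, orthonormal_iff_ite.1 (OrthonormalBasis.orthonormal _) i j]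
  simp

theorem singularValues_smul_leftSingularVector (i : Fin n) :
    T.singularValues i • leftSingularVector T hn i = T (rightSingularBasis T hn i) := by
  rcases eq_or_ne (T.singularValues i) 0 with h | h
  · have hzero : T (rightSingularBasis T hn i) = 0 := by
      rw [← inner_self_eq_zero (𝕜 := ℝ), inner_apply_rightSingularBasis, if_pos rfl, h,
        zero_pow two_ne_zero]
    rw [h, zero_smul, hzero]
  · rw [leftSingularVector, smul_inv_smul₀ h]

theorem inner_leftSingularVector_apply (i : Fin n) :
    inner ℝ (leftSingularVector T hn i) (T (rightSingularBasis T hn i)) = T.singularValues i := by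
  rw [leftSingularVector, real_inner_smul_left, inner_apply_rightSingularBasis, if_pos rfl, pow_two,
    ← mul_assoc, inv_mul_mul_self]

theorem isBessel_leftSingularVector : IsBessel (leftSingularVector T hn) := by
  refine isBessel_of_inner_eq (w := fun i => (T.singularValues i)⁻¹ * T.singularValues i)
    (fun i => inv_mul_le_one) fun i j => ?_
  rw [leftSingularVector, leftSingularVector, real_inner_smul_left, real_inner_smul_right,
    inner_apply_rightSingularBasis]
  split_ifs with h
  · subst h
    field_simp
  · simp

theorem apply_eq_sum_leftSingularVector (x : E) :
    T x = ∑ i : Fin n, (T.singularValues i * inner ℝ (rightSingularBasis T hn i) x) •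
      leftSingularVector T hn i := by
  conv_lhs => rw [← (rightSingularBasis T hn).sum_repr' x]
  simp only [map_sum, map_smul, mul_comm (T.singularValues _), mul_smul,
    singularValues_smul_leftSingularVector]

variable {T} in
theorem isSingularValueDecomposition_castLE {m : ℕ} (hm : Module.finrank ℝ F = m) :
    IsSingularValueDecomposition T (fun i : Fin (min m n) => T.singularValues i)
      (leftSingularVector T hn ∘ Fin.castLE (min_le_right m n))
      (rightSingularBasis T hn ∘ Fin.castLE (min_le_right m n)) where
  left := (isBessel_leftSingularVector T hn).comp_injective (Fin.castLE_injective _)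
  right := (isBessel_of_orthonormal (rightSingularBasis T hn).orthonormal).comp_injective
    (Fin.castLE_injective _)
  apply_eq_sum x := by
    rw [apply_eq_sum_leftSingularVector T hn x]
    refine (Finset.sum_of_injOn (Fin.castLE (min_le_right m n)) (Fin.castLE_injective _).injOn
      (fun _ _ => Finset.mem_univ _) (fun i _ hi => ?_) fun i _ => rfl).symm
    have hmi : m ≤ i := by
      by_contra! hlt
      exact hi ⟨⟨i, lt_min hlt i.2⟩, Finset.mem_coe.2 (Finset.mem_univ _), rfl⟩
    have hzero : T.singularValues i = 0 :=
      T.singularValues_eq_zero_iff_le_finrank_range.2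
        ((Submodule.finrank_le _).trans (hm.trans_le hmi))
    rw [hzero, zero_mul, zero_smul]
  inner_apply i := inner_leftSingularVector_apply T hn (Fin.castLE (min_le_right m n) i)

end SingularValueDecomposition

section Schatten

variable {m n : ℕ}

theorem exists_isSingularValueDecomposition (X : Matrix (Fin m) (Fin n) ℝ) :
    ∃ u v, IsSingularValueDecomposition (Matrix.toEuclideanLin X) (singularVector X) u v :=
  ⟨_, _, isSingularValueDecomposition_castLE finrank_euclideanSpace_fin finrank_euclideanSpace_fin⟩

theorem singularVector_eq_zero_iff {X : Matrix (Fin m) (Fin n) ℝ} :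
    singularVector X = 0 ↔ X = 0 := by
  refine ⟨fun h => ?_, ?_⟩
  · obtain ⟨u, v, hX⟩ := exists_isSingularValueDecomposition X
    refine (map_eq_zero_iff _ Matrix.toEuclideanLin.injective).1 (LinearMap.ext fun x => ?_)
    simp [hX.apply_eq_sum, h]
  · rintro rfl
    ext i
    simp [singularVector]

variable (r : ℝ≥0∞) [Fact (1 ≤ r)]

/-- Expanding `X` in singular vectors `(u j, v j)` gives
`⟪a i, X (b i)⟫ = ∑ j, σ j * ⟪a i, u j⟫ * ⟪v j, b i⟫`, whose coefficients are doubly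
substochastic by Bessel's inequality. -/
theorem lrNorm_inner_le_lrNorm_singularVector (X : Matrix (Fin m) (Fin n) ℝ) {l : ℕ}
    {a : Fin l → EuclideanSpace ℝ (Fin m)} {b : Fin l → EuclideanSpace ℝ (Fin n)}
    (ha : IsBessel a) (hb : IsBessel b) :
    lrNorm r (WithLp.toLp 2 fun i => inner ℝ (a i) (Matrix.toEuclideanLin X (b i))) ≤
      lrNorm r (singularVector X) := by
  obtain ⟨u, v, hX⟩ := exists_isSingularValueDecomposition X
  refine lrNorm_le_of_doubly_substochastic
    (Q := fun i j => |inner ℝ (u j) (a i)| * |inner ℝ (v j) (b i)|)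
    (fun i j => by positivity)
    (fun i => (hX.left.sum_abs_mul_abs_le hX.right _ _).trans
      (mul_le_one₀ (ha.norm_le_one i) (norm_nonneg _) (hb.norm_le_one i)))
    (fun j => ?_) (fun i => ?_)
  · simp only [real_inner_comm (a _) (u j), real_inner_comm (b _) (v j)]
    exact (ha.sum_abs_mul_abs_le hb _ _).trans
      (mul_le_one₀ (hX.left.norm_le_one j) (norm_nonneg _) (hX.right.norm_le_one j))
  · simp only [hX.apply_eq_sum, inner_sum, inner_smul_right]
    refine (Finset.abs_sum_le_sum_abs _ _).trans_eq (Finset.sum_congr rfl fun j _ => ?_)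
    rw [abs_mul, abs_mul, real_inner_comm (a i) (u j)]
    ring

theorem lrNorm_singularVector_add_le (X Y : Matrix (Fin m) (Fin n) ℝ) :
    lrNorm r (singularVector (X + Y)) ≤
      lrNorm r (singularVector X) + lrNorm r (singularVector Y) := by
  obtain ⟨u, v, h⟩ := exists_isSingularValueDecomposition (X + Y)
  have hXY : singularVector (X + Y) =
      WithLp.toLp 2 (fun i => inner ℝ (u i) (Matrix.toEuclideanLin X (v i))) +
        WithLp.toLp 2 (fun i => inner ℝ (u i) (Matrix.toEuclideanLin Y (v i))) := by
    ext i
    rw [← h.inner_apply i]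
    simp [inner_add_right]
  rw [hXY]
  exact (map_add_le_add (lrSeminorm _ r) _ _).trans
    (add_le_add (lrNorm_inner_le_lrNorm_singularVector r X h.left h.right)
      (lrNorm_inner_le_lrNorm_singularVector r Y h.left h.right))

theorem lrNorm_singularVector_smul_le (c : ℝ) (X : Matrix (Fin m) (Fin n) ℝ) :
    lrNorm r (singularVector (c • X)) ≤ ‖c‖ * lrNorm r (singularVector X) := by
  obtain ⟨u, v, h⟩ := exists_isSingularValueDecomposition (c • X)
  have hX : singularVector (c • X) =
      c • WithLp.toLp 2 (fun i => inner ℝ (u i) (Matrix.toEuclideanLin X (v i))) := by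
    ext i
    rw [← h.inner_apply i]
    simp [inner_smul_right]
  rw [hX, ← coe_lrSeminorm, map_smul_eq_mul]
  exact mul_le_mul_of_nonneg_left (lrNorm_inner_le_lrNorm_singularVector r X h.left h.right)
    (norm_nonneg c)

/-- The Schatten `r`-norm, that is, the `ℓ_r` norm of the singular values, as a seminorm. -/
noncomputable def schattenSeminorm (m n : ℕ) (r : ℝ≥0∞) [Fact (1 ≤ r)] :
    Seminorm ℝ (Matrix (Fin m) (Fin n) ℝ) :=
  Seminorm.ofSMulLE (fun X => lrNorm r (singularVector X))
    (lrNorm_eq_zero_iff.2 (singularVector_eq_zero_iff.2 rfl))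
    (lrNorm_singularVector_add_le r) (lrNorm_singularVector_smul_le r)

end Schatten

section Frobenius

variable {m n : ℕ}

theorem frobInner_eq_sum (X Y : Matrix (Fin m) (Fin n) ℝ) :
    frobInner X Y = ∑ i, ∑ j, X i j * Y i j := by
  rw [frobInner, Matrix.trace, Finset.sum_comm]
  simp only [Matrix.diag_apply, Matrix.mul_apply, Matrix.transpose_apply]

theorem abs_frobInner_le (X Y : Matrix (Fin m) (Fin n) ℝ) :
    |frobInner X Y| ≤ frobNorm X * frobNorm Y := by
  simp only [frobNorm, frobInner_eq_sum, ← pow_two, ← Fintype.sum_prod_type']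
  rw [← Real.sqrt_mul (Finset.sum_nonneg fun _ _ => sq_nonneg _)]
  exact Real.abs_le_sqrt (Finset.sum_mul_sq_le_sq_mul_sq _ _ _)

attribute [local instance] Matrix.frobeniusNormedAddCommGroup in
theorem frobNorm_eq_norm (X : Matrix (Fin m) (Fin n) ℝ) : frobNorm X = ‖X‖ := by
  rw [Matrix.frobenius_norm_def, frobNorm, frobInner_eq_sum, Real.sqrt_eq_rpow]
  simp only [← pow_two, Real.rpow_two, Real.norm_eq_abs, sq_abs]

end Frobenius

section AugmentedLagrangian

variable {V W : Type*} [NormedAddCommGroup V] [NormedSpace ℝ V]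
  [NormedAddCommGroup W] [InnerProductSpace ℝ W]

/-- The problem of minimizing `f v` subject to `c - T v ∈ Q`, which augmented Lagrangian methods
split as `T v + y = c` with `y ∈ Q`. -/
structure SplitProblem (V W : Type*) [NormedAddCommGroup V] [NormedSpace ℝ V]
    [NormedAddCommGroup W] [InnerProductSpace ℝ W] where
  f : V → ℝ
  T : V →L[ℝ] W
  c : W
  Q : Set W

namespace SplitProblem

variable (S : SplitProblem V W)

/-- The set of points satisfying the constraint. -/
def feasible : Set V := {v | S.c - S.T v ∈ S.Q}

/-- The violation of the split constraint `T v + y = c`. -/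
def residual (v : V) (y : W) : W := S.T v + y - S.c

/-- The augmented Lagrangian with penalty parameter `l` and multiplier `θ`, scaled by `l` and with
the square completed. -/
noncomputable def augLagrangian (l : ℝ) (θ : W) (v : V) (y : W) : ℝ :=
  l * S.f v + 1 / 2 * ‖S.residual v y - l • θ‖ ^ 2

/-- Minimality of `(v, y)` up to `ε` for the augmented Lagrangian subproblem. -/
def IsApproxMinimizer (l ε : ℝ) (θ : W) (v : V) (y : W) : Prop :=
  ∀ v', ∀ y' ∈ S.Q, S.augLagrangian l θ v y ≤ S.augLagrangian l θ v' y' + ε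

/-- Stationarity of `(v, y)` for the augmented Lagrangian subproblem, up to a subgradient of norm
`τ` in `v` and up to `ξ` in the variational inequality in `y`. -/
def IsApproxStationary (l τ ξ : ℝ) (θ : W) (v : V) (y : W) : Prop :=
  (∀ v', S.augLagrangian l θ v y ≤ S.augLagrangian l θ v' y + τ * ‖v' - v‖) ∧
    ∀ y' ∈ S.Q, inner ℝ (S.residual v y - l • θ) (y - y') ≤ ξ

/-- The sequences `v`, `y` and `θ`, indexed by `k ≥ 1`, are generated by the inexact augmented
Lagrangian method with penalty parameters `lam` and tolerances `ε`, `τ` and `ξ`. -/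
structure IsRun (lam ε τ ξ : ℕ → ℝ) (v : ℕ → V) (y θ : ℕ → W) : Prop where
  y_mem : ∀ k, 1 ≤ k → y k ∈ S.Q
  accept : ∀ k, 1 ≤ k → S.IsApproxMinimizer (lam k) (ε k) (θ k) (v k) (y k) ∨
    S.IsApproxStationary (lam k) (τ k) (ξ k) (θ k) (v k) (y k)
  multiplier_succ : ∀ k, 1 ≤ k → θ (k + 1) = θ k - (lam k)⁻¹ • S.residual (v k) (y k)

end SplitProblem

/-- The conditions on penalty parameters `lam` and tolerances `ε`, `τ` and `ξ`, indexed by `k ≥ 1`,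
under which the inexact augmented Lagrangian method converges. -/
structure IsAdmissibleSchedule (lam ε τ ξ : ℕ → ℝ) : Prop where
  lam_pos : ∀ k, 1 ≤ k → 0 < lam k
  tendsto_lam : Tendsto lam atTop (𝓝 0)
  exists_ε_div_sq_le : ∃ B, ∀ k, 1 ≤ k → ε k / lam k ^ 2 ≤ B
  tendsto_τ_div : Tendsto (fun k => τ k / lam k) atTop (𝓝 0)
  tendsto_ξ_div : Tendsto (fun k => ξ k / lam k) atTop (𝓝 0)

theorem IsAdmissibleSchedule.const_mul_τ {lam ε τ ξ : ℕ → ℝ}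
    (h : IsAdmissibleSchedule lam ε τ ξ) (c : ℝ) :
    IsAdmissibleSchedule lam ε (fun k => c * τ k) ξ where
  __ := h
  tendsto_τ_div := by simpa only [mul_div_assoc, mul_zero] using h.tendsto_τ_div.const_mul c

theorem nonneg_of_forall_nonneg_mul_add_mul_sq {a b : ℝ}
    (h : ∀ t ∈ Ioc (0 : ℝ) 1, 0 ≤ t * a + t ^ 2 * b) : 0 ≤ a := by
  have hlim : Tendsto (fun t : ℝ => a + t * b) (𝓝[>] 0) (𝓝 a) := by
    have : Continuous fun t : ℝ => a + t * b := by fun_prop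
    simpa using (this.tendsto 0).mono_left nhdsWithin_le_nhds
  refine ge_of_tendsto hlim ?_
  filter_upwards [Ioc_mem_nhdsGT one_pos] with t ht
  refine nonneg_of_mul_nonneg_right ?_ ht.1
  linarith [h t ht]

theorem le_mul_of_sq_le_mul_add {r l M B : ℝ} (hl : 0 < l) (hM : 0 ≤ M) (hB : 0 ≤ B)
    (h : r ^ 2 ≤ 2 * (l * M * r + B * l ^ 2)) : r ≤ l * (2 * M + 2 * B + 1) := by
  by_contra! hr
  have hrl : l * (2 * B + 1) ≤ r - 2 * (l * M) := by linarith
  have hr' : l * (2 * B + 1) ≤ r := by nlinarith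
  have : (l * (2 * B + 1)) * (l * (2 * B + 1)) ≤ r * (r - 2 * (l * M)) :=
    mul_le_mul hr' hrl (by positivity) (hr'.trans' (by positivity))
  nlinarith [mul_pos hl hl, sq_nonneg (B * l)]

namespace SplitProblem

variable {S : SplitProblem V W} {l ε τ ξ : ℝ} {θ y : W} {v v' : V}

theorem residual_self_sub (v : V) : S.residual v (S.c - S.T v) = 0 := by simp [residual]

theorem augLagrangian_of_split (l : ℝ) (θ : W) (v : V) :
    S.augLagrangian l θ v (S.c - S.T v) = l * S.f v + l ^ 2 / 2 * ‖θ‖ ^ 2 := by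
  rw [augLagrangian, residual_self_sub, zero_sub, norm_neg, norm_smul, mul_pow, Real.norm_eq_abs,
    sq_abs]
  ring

/-- The idea is to compare `v` with the point obtained by solving away the shifted residual, at
which the quadratic penalty vanishes. -/
theorem norm_residual_sub_smul_le {L : ℝ≥0} {a B : ℝ}
    (hf : LipschitzWith L S.f) (hT : ∀ w, ∃ u, S.T u = w ∧ ‖u‖ ≤ a * ‖w‖)
    (ha : 0 ≤ a) (hB : 0 ≤ B) (hl : 0 < l)
    (h : ∀ v', S.augLagrangian l θ v y ≤
      S.augLagrangian l θ v' y + (B * l ^ 2 + l * ‖v' - v‖)) :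
    ‖S.residual v y - l • θ‖ ≤ l * (2 * ((L + 1) * a) + 2 * B + 1) := by
  obtain ⟨u, hu, hua⟩ := hT (S.residual v y - l • θ)
  have hzero : S.residual (v - u) y - l • θ = 0 := by
    rw [← sub_self (S.T u), residual, map_sub]
    nth_rw 2 [hu]
    rw [residual]
    abel
  have hcomp := h (v - u)
  rw [augLagrangian, augLagrangian, hzero, norm_zero, sub_sub_cancel_left, norm_neg] at hcomp
  have hlip := hf.le_add_mul (v - u) v
  rw [dist_eq_norm, sub_sub_cancel_left, norm_neg] at hlip
  refine le_mul_of_sq_le_mul_add hl (by positivity) hB ?_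
  have h1 := mul_le_mul_of_nonneg_left hlip hl.le
  have h2 := mul_le_mul_of_nonneg_left hua (by positivity : 0 ≤ l * (L + 1))
  linarith

theorem IsApproxMinimizer.mul_le (h : S.IsApproxMinimizer l ε θ v y) (hv' : v' ∈ S.feasible) :
    l * S.f v ≤ l * S.f v' + l ^ 2 / 2 * ‖θ‖ ^ 2 + ε :=
  calc l * S.f v ≤ S.augLagrangian l θ v y := le_add_of_nonneg_right (by positivity)
    _ ≤ S.augLagrangian l θ v' (S.c - S.T v') + ε := h v' _ hv'
    _ = l * S.f v' + l ^ 2 / 2 * ‖θ‖ ^ 2 + ε := by rw [augLagrangian_of_split]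

theorem neg_mul_le_of_forall_augLagrangian_le (hf : ConvexOn ℝ univ S.f) (hl : 0 ≤ l)
    (h : ∀ v', S.augLagrangian l θ v y ≤ S.augLagrangian l θ v' y + τ * ‖v' - v‖) (v' : V) :
    -(τ * ‖v' - v‖) ≤
      l * (S.f v' - S.f v) + inner ℝ (S.residual v y - l • θ) (S.T (v' - v)) := by
  rw [← sub_nonneg]
  refine nonneg_of_forall_nonneg_mul_add_mul_sq (b := 1 / 2 * ‖S.T (v' - v)‖ ^ 2) fun t ht => ?_
  have hres : S.residual (v + t • (v' - v)) y - l • θ =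
      (S.residual v y - l • θ) + t • S.T (v' - v) := by
    simp only [residual, map_add, map_smul]
    abel
  have hconv : S.f (v + t • (v' - v)) ≤ S.f v + t * (S.f v' - S.f v) := by
    have := hf.2 (mem_univ v) (mem_univ v') (sub_nonneg.2 ht.2) ht.1.le (sub_add_cancel 1 t)
    rw [show v + t • (v' - v) = (1 - t) • v + t • v' by module]
    simp only [smul_eq_mul] at this
    linarith
  have hcomp := h (v + t • (v' - v))
  rw [augLagrangian, augLagrangian, hres, norm_add_sq_real, inner_smul_right, norm_smul,
    add_sub_cancel_left, norm_smul, Real.norm_of_nonneg ht.1.le] at hcomp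
  linarith [mul_le_mul_of_nonneg_left hconv hl]

theorem IsApproxStationary.mul_le (hf : ConvexOn ℝ univ S.f) (hl : 0 ≤ l)
    (h : S.IsApproxStationary l τ ξ θ v y) (hv' : v' ∈ S.feasible) :
    l * S.f v ≤ l * S.f v' + l ^ 2 / 2 * ‖θ‖ ^ 2 + ξ + τ * ‖v' - v‖ := by
  set w := S.residual v y - l • θ with hw
  have hsplit : S.T (v' - v) = (y - (S.c - S.T v')) - (w + l • θ) := by
    rw [hw, residual, map_sub]
    abel
  have hfirst := neg_mul_le_of_forall_augLagrangian_le hf hl h.1 v'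
  rw [← hw, hsplit, inner_sub_right] at hfirst
  have hvar : inner ℝ w (y - (S.c - S.T v')) ≤ ξ := h.2 _ hv'
  have hsq : -(l ^ 2 / 2 * ‖θ‖ ^ 2) ≤ inner ℝ w (w + l • θ) := by
    have hadd := norm_add_sq_real w (l • θ)
    rw [norm_smul, mul_pow, Real.norm_eq_abs, sq_abs] at hadd
    rw [inner_add_right, real_inner_self_eq_norm_sq]
    nlinarith [sq_nonneg ‖w + l • θ‖, sq_nonneg ‖w‖]
  linarith

namespace IsRun

variable {lam ε τ ξ : ℕ → ℝ} {v : ℕ → V} {y θ : ℕ → W}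

theorem smul_multiplier_succ (hrun : S.IsRun lam ε τ ξ v y θ) {k : ℕ} (hk : 1 ≤ k)
    (hlam : lam k ≠ 0) : lam k • θ (k + 1) = -(S.residual (v k) (y k) - lam k • θ k) := by
  rw [hrun.multiplier_succ k hk, smul_sub, smul_inv_smul₀ hlam, neg_sub]

theorem eventually_augLagrangian_le (hrun : S.IsRun lam ε τ ξ v y θ)
    (hpar : IsAdmissibleSchedule lam ε τ ξ) {B : ℝ} (hB : ∀ k, 1 ≤ k → ε k / lam k ^ 2 ≤ B) :
    ∀ᶠ k in atTop, ∀ v', S.augLagrangian (lam k) (θ k) (v k) (y k) ≤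
      S.augLagrangian (lam k) (θ k) v' (y k) + (|B| * lam k ^ 2 + lam k * ‖v' - v k‖) := by
  filter_upwards [eventually_ge_atTop 1, hpar.tendsto_τ_div.eventually_le_const one_pos]
    with k hk hτ v'
  have hl := hpar.lam_pos k hk
  have hε : ε k ≤ |B| * lam k ^ 2 :=
    (div_le_iff₀ (by positivity)).1 ((hB k hk).trans (le_abs_self B))
  have hτ' : τ k ≤ lam k := (div_le_one hl).1 hτ
  rcases hrun.accept k hk with h | h
  · linarith [h v' (y k) (hrun.y_mem k hk), mul_nonneg hl.le (norm_nonneg (v' - v k))]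
  · linarith [h.1 v', mul_le_mul_of_nonneg_right hτ' (norm_nonneg (v' - v k)),
      mul_nonneg (abs_nonneg B) (sq_nonneg (lam k))]

/-- The multiplier update turns the shifted residual into the next multiplier, so a residual bound
of order `lam k` bounds the multipliers. -/
theorem isBoundedUnder_norm_multiplier [CompleteSpace V] [CompleteSpace W]
    (hrun : S.IsRun lam ε τ ξ v y θ) (hpar : IsAdmissibleSchedule lam ε τ ξ) {L : ℝ≥0}
    (hf : LipschitzWith L S.f) (hT : Function.Surjective S.T) :
    IsBoundedUnder (· ≤ ·) atTop fun k => ‖θ k‖ := by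
  obtain ⟨B, hB⟩ := hpar.exists_ε_div_sq_le
  obtain ⟨a, ha, hTa⟩ := S.T.exists_preimage_norm_le hT
  rw [IsBoundedUnder, ← map_add_atTop_eq_nat 1, map_map]
  refine isBoundedUnder_of_eventually_le (a := 2 * ((L + 1) * a) + 2 * |B| + 1) ?_
  filter_upwards [eventually_ge_atTop 1, hrun.eventually_augLagrangian_le hpar hB] with k hk hcomp
  have hl := hpar.lam_pos k hk
  refine le_of_mul_le_mul_left ?_ hl
  calc lam k * ‖θ (k + 1)‖ = ‖lam k • θ (k + 1)‖ := by rw [norm_smul, Real.norm_of_nonneg hl.le]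
    _ = ‖S.residual (v k) (y k) - lam k • θ k‖ := by
      rw [hrun.smul_multiplier_succ hk hl.ne', norm_neg]
    _ ≤ _ := norm_residual_sub_smul_le hf hTa ha.le (abs_nonneg B) hl hcomp

theorem tendsto_residual (hrun : S.IsRun lam ε τ ξ v y θ)
    (hpar : IsAdmissibleSchedule lam ε τ ξ)
    (hθ : IsBoundedUnder (· ≤ ·) atTop fun k => ‖θ k‖) :
    Tendsto (fun k => S.residual (v k) (y k)) atTop (𝓝 0) := by
  have hsmul := hpar.tendsto_lam.zero_smul_isBoundedUnder_le hθ
  have hθ' : IsBoundedUnder (· ≤ ·) atTop (norm ∘ fun k => θ (k + 1)) := by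
    rwa [IsBoundedUnder, ← map_add_atTop_eq_nat 1, map_map] at hθ
  have hsmul' := hpar.tendsto_lam.zero_smul_isBoundedUnder_le hθ'
  rw [← sub_zero (0 : W)]
  refine (hsmul.sub hsmul').congr' ?_
  filter_upwards [eventually_ge_atTop 1] with k hk
  rw [hrun.smul_multiplier_succ hk (hpar.lam_pos k hk).ne']
  abel

theorem exists_eventually_le_add_mul_one_add_norm (hrun : S.IsRun lam ε τ ξ v y θ)
    (hpar : IsAdmissibleSchedule lam ε τ ξ) (hf : ConvexOn ℝ univ S.f)
    (hθ : IsBoundedUnder (· ≤ ·) atTop fun k => ‖θ k‖) :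
    ∃ δ : ℕ → ℝ, Tendsto δ atTop (𝓝 0) ∧
      ∀ᶠ k in atTop, ∀ v' ∈ S.feasible, S.f (v k) ≤ S.f v' + δ k * (1 + ‖v' - v k‖) := by
  obtain ⟨B, hB⟩ := hpar.exists_ε_div_sq_le
  obtain ⟨K, hK⟩ := hθ.eventually_le
  refine ⟨fun k => lam k * (K ^ 2 / 2 + |B|) + |ξ k / lam k| + |τ k / lam k|, ?_, ?_⟩
  · simpa using ((hpar.tendsto_lam.mul_const (K ^ 2 / 2 + |B|)).add
      hpar.tendsto_ξ_div.abs).add hpar.tendsto_τ_div.abs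
  filter_upwards [eventually_ge_atTop 1, hK] with k hk hθk v' hv'
  have hl := hpar.lam_pos k hk
  set d := ‖v' - v k‖
  have hε : ε k ≤ |B| * lam k ^ 2 :=
    (div_le_iff₀ (by positivity)).1 ((hB k hk).trans (le_abs_self B))
  have hξ : ξ k ≤ |ξ k / lam k| * lam k := (div_le_iff₀ hl).1 (le_abs_self _)
  have hτ : τ k * d ≤ |τ k / lam k| * lam k * d := by
    gcongr
    exact (div_le_iff₀ hl).1 (le_abs_self _)
  have hθk' : lam k ^ 2 / 2 * ‖θ k‖ ^ 2 ≤ lam k ^ 2 / 2 * K ^ 2 := by gcongr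
  have hbound : lam k * S.f (v k) ≤ lam k * S.f v' + lam k ^ 2 * (K ^ 2 / 2 + |B|) +
      |ξ k / lam k| * lam k + |τ k / lam k| * lam k * d := by
    rcases hrun.accept k hk with h | h
    · have : 0 ≤ |ξ k / lam k| * lam k + |τ k / lam k| * lam k * d := by positivity
      linarith [h.mul_le hv']
    · have : 0 ≤ |B| * lam k ^ 2 := by positivity
      linarith [h.mul_le hf hl.le hv']
  have hslack : 0 ≤ lam k ^ 2 * (K ^ 2 / 2 + |B|) * d + |ξ k / lam k| * lam k * d +
      |τ k / lam k| * lam k := by positivity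
  refine le_of_mul_le_mul_left ?_ hl
  linarith

theorem isBoundedUnder_norm (hrun : S.IsRun lam ε τ ξ v y θ)
    (hpar : IsAdmissibleSchedule lam ε τ ξ) (hf : ConvexOn ℝ univ S.f)
    (hθ : IsBoundedUnder (· ≤ ·) atTop fun k => ‖θ k‖) (hfeas : S.feasible.Nonempty)
    (hQ : Bornology.IsBounded S.Q) {a : ℝ} (ha : 0 ≤ a)
    (hcoercive : ∀ v, ‖v‖ ≤ a * (S.f v + ‖S.T v‖)) :
    IsBoundedUnder (· ≤ ·) atTop fun k => ‖v k‖ := by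
  obtain ⟨v₀, hv₀⟩ := hfeas
  obtain ⟨M, hM⟩ := hQ.exists_norm_le
  obtain ⟨δ, hδ, hδf⟩ := hrun.exists_eventually_le_add_mul_one_add_norm hpar hf hθ
  have hTv : ∀ᶠ k in atTop, ‖S.T (v k)‖ ≤ 1 + ‖S.c‖ + M := by
    filter_upwards [eventually_ge_atTop 1,
      (hrun.tendsto_residual hpar hθ).norm.eventually_le_const (norm_zero.trans_lt one_pos)]
      with k hk hres
    calc ‖S.T (v k)‖ = ‖S.residual (v k) (y k) + S.c - y k‖ := by rw [residual]; congr 1; abel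
      _ ≤ ‖S.residual (v k) (y k)‖ + ‖S.c‖ + ‖y k‖ :=
        (norm_sub_le _ _).trans (add_le_add_left (norm_add_le _ _) _)
      _ ≤ 1 + ‖S.c‖ + M := by gcongr; exact hM _ (hrun.y_mem k hk)
  have hδa : ∀ᶠ k in atTop, a * |δ k| ≤ 1 / 2 :=
    (hδ.abs.const_mul a).eventually_le_const (by simp)
  refine isBoundedUnder_of_eventually_le
    (a := 2 * (a * (S.f v₀ + (1 + ‖S.c‖ + M))) + (1 + ‖v₀‖)) ?_
  filter_upwards [hTv, hδa, hδf] with k hTk hδk hfk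
  have hfk' : S.f (v k) ≤ S.f v₀ + |δ k| * (1 + (‖v₀‖ + ‖v k‖)) :=
    (hfk v₀ hv₀).trans (by gcongr; exacts [le_abs_self _, norm_sub_le _ _])
  have habsorb : a * |δ k| * (1 + (‖v₀‖ + ‖v k‖)) ≤ 1 / 2 * (1 + (‖v₀‖ + ‖v k‖)) := by gcongr
  have hcoer : ‖v k‖ ≤
      a * (S.f v₀ + |δ k| * (1 + (‖v₀‖ + ‖v k‖)) + (1 + ‖S.c‖ + M)) :=
    (hcoercive (v k)).trans (by gcongr)
  linarith

theorem feasible_and_isMinOn_of_tendsto (hrun : S.IsRun lam ε τ ξ v y θ)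
    (hpar : IsAdmissibleSchedule lam ε τ ξ) (hf : ConvexOn ℝ univ S.f) (hfc : Continuous S.f)
    (hθ : IsBoundedUnder (· ≤ ·) atTop fun k => ‖θ k‖) (hQ : IsClosed S.Q)
    {φ : ℕ → ℕ} (hφ : Tendsto φ atTop atTop) {vbar : V}
    (hv : Tendsto (fun j => v (φ j)) atTop (𝓝 vbar)) :
    vbar ∈ S.feasible ∧ IsMinOn S.f S.feasible vbar := by
  obtain ⟨δ, hδ, hδf⟩ := hrun.exists_eventually_le_add_mul_one_add_norm hpar hf hθ
  constructor
  · have hy : Tendsto (fun j => S.residual (v (φ j)) (y (φ j)) + S.c - S.T (v (φ j))) atTop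
        (𝓝 (0 + S.c - S.T vbar)) :=
      (((hrun.tendsto_residual hpar hθ).comp hφ).add_const S.c).sub
        ((S.T.continuous.tendsto vbar).comp hv)
    rw [zero_add] at hy
    refine hQ.mem_of_tendsto hy ?_
    filter_upwards [hφ.eventually_ge_atTop 1] with j hj
    simpa [residual] using hrun.y_mem (φ j) hj
  · intro v' hv'
    have hbound : Tendsto (fun j => S.f v' + δ (φ j) * (1 + ‖v' - v (φ j)‖)) atTop
        (𝓝 (S.f v' + 0 * (1 + ‖v' - vbar‖))) :=
      tendsto_const_nhds.add ((hδ.comp hφ).mul ((hv.const_sub v').norm.const_add 1))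
    rw [zero_mul, add_zero] at hbound
    exact le_of_tendsto_of_tendsto ((hfc.tendsto vbar).comp hv) hbound
      ((hφ.eventually hδf).mono fun j h => h v' hv')

end IsRun

end SplitProblem

end AugmentedLagrangian

section SlackMap

variable {E F G : Type*} [NormedAddCommGroup E] [NormedSpace ℝ E] [NormedAddCommGroup F]
  [NormedSpace ℝ F] [NormedAddCommGroup G] [NormedSpace ℝ G]

/-- The map `(x, s) ↦ (A x, C x + s)` of the linear constraints in which `s` is a free slack
variable of the second one. -/
noncomputable def slackMap (A : E →L[ℝ] F) (C : E →L[ℝ] G) : E × G →L[ℝ] WithLp 2 (F × G) :=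
  (WithLp.prodContinuousLinearEquiv 2 ℝ F G).symm.toContinuousLinearMap ∘L
    (A ∘L ContinuousLinearMap.fst ℝ E G).prod
      (C ∘L ContinuousLinearMap.fst ℝ E G + ContinuousLinearMap.snd ℝ E G)

theorem slackMap_surjective {A : E →L[ℝ] F} (hA : Function.Surjective A) (C : E →L[ℝ] G) :
    Function.Surjective (slackMap A C) := by
  intro w
  obtain ⟨x, hx⟩ := hA w.fst
  refine ⟨(x, w.snd - C x), ?_⟩
  change WithLp.toLp 2 (A x, C x + (w.snd - C x)) = w
  rw [hx, add_sub_cancel]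
  rfl

end SlackMap

section FALC

-- The topology of the Frobenius norm is definitionally the product topology on matrices.
attribute [local instance] Matrix.frobeniusNormedAddCommGroup Matrix.frobeniusNormedSpace

namespace CompositeProblem

variable {m n p q : ℕ} (D : CompositeProblem m n p q)

/-- The composite norm minimization problem in the variables `v = (X, s)`, with both constraints
`A X + y = b` and `C X + s = d` collected in the second space. The slack `y` is identified with
`(y, 0)`. -/
noncomputable def toSplitProblem :
    SplitProblem (Matrix (Fin m) (Fin n) ℝ × EuclideanSpace ℝ (Fin p))
      (WithLp 2 (EuclideanSpace ℝ (Fin q) × EuclideanSpace ℝ (Fin p))) where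
  f v := D.μ₁ * lrNorm D.α (singularVector v.1) + D.μ₂ * lrNorm D.β v.2
  T := slackMap D.A.toContinuousLinearMap D.C.toContinuousLinearMap
  c := WithLp.toLp 2 (D.b, D.d)
  Q := {w | lrNorm D.γ w.fst ≤ D.ρ ∧ w.snd = 0}

variable {D}

theorem toSplitProblem_residual (X : Matrix (Fin m) (Fin n) ℝ) (s : EuclideanSpace ℝ (Fin p))
    (y : EuclideanSpace ℝ (Fin q)) :
    D.toSplitProblem.residual (X, s) (WithLp.toLp 2 (y, 0)) =
      WithLp.toLp 2 (D.A X + y - D.b, D.C X + s - D.d) := by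
  rw [← add_zero (D.C X + s)]
  rfl

theorem toSplitProblem_augLagrangian (l : ℝ) (θ₁ : EuclideanSpace ℝ (Fin q))
    (θ₂ : EuclideanSpace ℝ (Fin p)) (X : Matrix (Fin m) (Fin n) ℝ) (s : EuclideanSpace ℝ (Fin p))
    (y : EuclideanSpace ℝ (Fin q)) :
    D.toSplitProblem.augLagrangian l (WithLp.toLp 2 (θ₁, θ₂)) (X, s) (WithLp.toLp 2 (y, 0)) =
      D.penalized l θ₁ θ₂ X s y := by
  rw [SplitProblem.augLagrangian, toSplitProblem_residual, WithLp.prod_norm_sq_eq_of_L2, mul_add]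
  rfl

theorem mk_mem_feasible_toSplitProblem_iff [Fact (1 ≤ D.γ)] {X : Matrix (Fin m) (Fin n) ℝ}
    {s : EuclideanSpace ℝ (Fin p)} :
    (X, s) ∈ D.toSplitProblem.feasible ↔ X ∈ D.feasible ∧ s = D.d - D.C X := by
  change lrNorm D.γ (D.b - D.A X) ≤ D.ρ ∧ D.d - (D.C X + s) = 0 ↔
    lrNorm D.γ (D.A X - D.b) ≤ D.ρ ∧ _
  rw [lrNorm_sub_comm, sub_eq_zero, eq_comm, eq_sub_iff_add_eq']

theorem toSplitProblem_f_mk_sub [Fact (1 ≤ D.β)] (X : Matrix (Fin m) (Fin n) ℝ) :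
    D.toSplitProblem.f (X, D.d - D.C X) = D.objective X := by
  rw [objective, lrNorm_sub_comm]
  rfl

theorem isOptimal_of_isMinOn [Fact (1 ≤ D.β)] [Fact (1 ≤ D.γ)] {X : Matrix (Fin m) (Fin n) ℝ}
    {s : EuclideanSpace ℝ (Fin p)} (hmem : (X, s) ∈ D.toSplitProblem.feasible)
    (hmin : IsMinOn D.toSplitProblem.f D.toSplitProblem.feasible (X, s)) : D.IsOptimal X := by
  obtain ⟨hX, rfl⟩ := mk_mem_feasible_toSplitProblem_iff.1 hmem
  refine ⟨hX, fun Y hY => ?_⟩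
  have hle := isMinOn_iff.1 hmin _ (mk_mem_feasible_toSplitProblem_iff.2 ⟨hY, rfl⟩)
  rwa [toSplitProblem_f_mk_sub, toSplitProblem_f_mk_sub] at hle

theorem surjective_toSplitProblem_T (hA : Function.Surjective D.A) :
    Function.Surjective D.toSplitProblem.T :=
  slackMap_surjective (A := D.A.toContinuousLinearMap) hA _

theorem isClosed_toSplitProblem_Q [Fact (1 ≤ D.γ)] : IsClosed D.toSplitProblem.Q :=
  ((isClosed_lrNorm_le D.ρ).preimage (WithLp.continuous_fst 2 _ _)).inter
    (isClosed_singleton.preimage (WithLp.continuous_snd 2 _ _))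

theorem isBounded_toSplitProblem_Q [Fact (1 ≤ D.γ)] :
    Bornology.IsBounded D.toSplitProblem.Q := by
  obtain ⟨M, hM⟩ := (isBounded_lrNorm_le (k := q) (r := D.γ) D.ρ).exists_norm_le
  refine isBounded_iff_forall_norm_le.2 ⟨M, fun w hw => ?_⟩
  have hnorm : ‖w‖ = ‖w.fst‖ := by
    rw [WithLp.prod_norm_eq_of_L2, hw.2, norm_zero, zero_pow two_ne_zero, add_zero,
      Real.sqrt_sq (norm_nonneg _)]
  exact hnorm.trans_le (hM _ hw.1)

variable (D) in
/-- The objective of `toSplitProblem` as a seminorm, for nonnegative weights. -/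
noncomputable def splitSeminorm [Fact (1 ≤ D.α)] [Fact (1 ≤ D.β)] :
    Seminorm ℝ (Matrix (Fin m) (Fin n) ℝ × EuclideanSpace ℝ (Fin p)) :=
  D.μ₁.toNNReal • (schattenSeminorm m n D.α).comp (LinearMap.fst ℝ _ _) +
    D.μ₂.toNNReal • (lrSeminorm p D.β).comp (LinearMap.snd ℝ _ _)

theorem coe_splitSeminorm [Fact (1 ≤ D.α)] [Fact (1 ≤ D.β)] (hμ₁ : 0 ≤ D.μ₁) (hμ₂ : 0 ≤ D.μ₂) :
    ⇑D.splitSeminorm = D.toSplitProblem.f := by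
  funext v
  change (D.μ₁.toNNReal : ℝ) * lrNorm D.α (singularVector v.1) +
    (D.μ₂.toNNReal : ℝ) * lrNorm D.β v.2 = _
  rw [Real.coe_toNNReal _ hμ₁, Real.coe_toNNReal _ hμ₂]
  rfl

theorem eq_zero_of_toSplitProblem_f_eq_zero [Fact (1 ≤ D.α)] [Fact (1 ≤ D.β)]
    (hμ₁ : 0 ≤ D.μ₁) (hμ₂ : 0 ≤ D.μ₂)
    (h : 0 < D.μ₁ ∨ 0 < D.μ₂ ∧ Disjoint (LinearMap.ker D.A) (LinearMap.ker D.C))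
    {X : Matrix (Fin m) (Fin n) ℝ} {s : EuclideanSpace ℝ (Fin p)}
    (hf : D.toSplitProblem.f (X, s) = 0) (hT : D.toSplitProblem.T (X, s) = 0) : (X, s) = 0 := by
  obtain ⟨hX, hs⟩ := (add_eq_zero_iff_of_nonneg (mul_nonneg hμ₁ (lrNorm_nonneg _ _))
    (mul_nonneg hμ₂ (lrNorm_nonneg _ _))).1 hf
  have hAX : D.A X = 0 := congrArg WithLp.fst hT
  have hCX : D.C X + s = 0 := congrArg WithLp.snd hT
  rcases h with hpos | ⟨hpos, hker⟩
  · obtain rfl : X = 0 :=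
      singularVector_eq_zero_iff.1 (lrNorm_eq_zero_iff.1 ((mul_eq_zero_iff_left hpos.ne').1 hX))
    rw [map_zero, zero_add] at hCX
    rw [hCX, Prod.mk_zero_zero]
  · obtain rfl : s = 0 := lrNorm_eq_zero_iff.1 ((mul_eq_zero_iff_left hpos.ne').1 hs)
    rw [add_zero] at hCX
    rw [Submodule.disjoint_def.1 hker X hAX hCX, Prod.mk_zero_zero]

theorem exists_norm_le_mul_toSplitProblem [Fact (1 ≤ D.α)] [Fact (1 ≤ D.β)]
    (hμ₁ : 0 ≤ D.μ₁) (hμ₂ : 0 ≤ D.μ₂)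
    (h : 0 < D.μ₁ ∨ 0 < D.μ₂ ∧ Disjoint (LinearMap.ker D.A) (LinearMap.ker D.C)) :
    ∃ a : ℝ, 0 ≤ a ∧ ∀ v, ‖v‖ ≤ a * (D.toSplitProblem.f v + ‖D.toSplitProblem.T v‖) := by
  rw [← coe_splitSeminorm hμ₁ hμ₂]
  refine exists_norm_le_mul_seminorm (D.splitSeminorm +
    (normSeminorm ℝ _).comp D.toSplitProblem.T.toLinearMap) fun v hv => ?_
  obtain ⟨hf, hT⟩ := (add_eq_zero_iff_of_nonneg (apply_nonneg D.splitSeminorm v)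
    (norm_nonneg (D.toSplitProblem.T v))).1 hv
  rw [coe_splitSeminorm hμ₁ hμ₂] at hf
  exact eq_zero_of_toSplitProblem_f_eq_zero hμ₁ hμ₂ h hf (norm_eq_zero.1 hT)

theorem toSplitProblem_f_nonneg [Fact (1 ≤ D.α)] [Fact (1 ≤ D.β)] (hμ₁ : 0 ≤ D.μ₁)
    (hμ₂ : 0 ≤ D.μ₂) (v : Matrix (Fin m) (Fin n) ℝ × EuclideanSpace ℝ (Fin p)) :
    0 ≤ D.toSplitProblem.f v :=
  add_nonneg (mul_nonneg hμ₁ (lrNorm_nonneg _ _)) (mul_nonneg hμ₂ (lrNorm_nonneg _ _))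

theorem exists_lipschitzWith_toSplitProblem_f [Fact (1 ≤ D.α)] [Fact (1 ≤ D.β)]
    (hμ₁ : 0 ≤ D.μ₁) (hμ₂ : 0 ≤ D.μ₂) : ∃ L : ℝ≥0, LipschitzWith L D.toSplitProblem.f :=
  coe_splitSeminorm hμ₁ hμ₂ ▸ exists_lipschitzWith_seminorm D.splitSeminorm

theorem convexOn_toSplitProblem_f [Fact (1 ≤ D.α)] [Fact (1 ≤ D.β)]
    (hμ₁ : 0 ≤ D.μ₁) (hμ₂ : 0 ≤ D.μ₂) : ConvexOn ℝ univ D.toSplitProblem.f :=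
  coe_splitSeminorm hμ₁ hμ₂ ▸ D.splitSeminorm.convexOn

theorem forall_mem_toSplitProblem_Q_iff
    {P : WithLp 2 (EuclideanSpace ℝ (Fin q) × EuclideanSpace ℝ (Fin p)) → Prop} :
    (∀ w ∈ D.toSplitProblem.Q, P w) ↔ ∀ y, lrNorm D.γ y ≤ D.ρ → P (WithLp.toLp 2 (y, 0)) := by
  refine ⟨fun h y hy => h _ ⟨hy, rfl⟩, fun h w hw => ?_⟩
  have hw' : w = WithLp.toLp 2 (w.fst, 0) := by
    rw [← hw.2]
    rfl
  rw [hw']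
  exact h w.fst hw.1

theorem gradY_eq (l : ℝ) (θ₁ : EuclideanSpace ℝ (Fin q)) (θ₂ : EuclideanSpace ℝ (Fin p))
    (X : Matrix (Fin m) (Fin n) ℝ) (s : EuclideanSpace ℝ (Fin p))
    (y : EuclideanSpace ℝ (Fin q)) :
    D.gradY l θ₁ θ₂ X s y = D.A X + y - D.b - l • θ₁ := by
  refine HasGradientAt.gradient ?_
  rw [hasGradientAt_iff_hasFDerivAt]
  have hres : HasFDerivAt (fun y' : EuclideanSpace ℝ (Fin q) => D.A X + y' - D.b - l • θ₁)
      (ContinuousLinearMap.id ℝ _) y :=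
    (((hasFDerivAt_id y).const_add _).sub_const _).sub_const _
  refine (((hres.norm_sq.const_mul (1 / 2)).add_const
    (1 / 2 * ‖D.C X + s - D.d - l • θ₂‖ ^ 2)).const_add
      (l * D.toSplitProblem.f (X, s))).congr_fderiv ?_
  ext w
  simp

section Stopping

variable {l ε τ ξ η : ℝ} {θ₁ : EuclideanSpace ℝ (Fin q)} {θ₂ : EuclideanSpace ℝ (Fin p)}
  {X : Matrix (Fin m) (Fin n) ℝ} {s : EuclideanSpace ℝ (Fin p)} {y : EuclideanSpace ℝ (Fin q)}

theorem StopA.isApproxMinimizer [Fact (1 ≤ D.α)] [Fact (1 ≤ D.β)] (hμ₁ : 0 ≤ D.μ₁)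
    (hμ₂ : 0 ≤ D.μ₂) (hl : 0 ≤ l) (h : D.StopA l ε θ₁ θ₂ X s y) :
    D.toSplitProblem.IsApproxMinimizer l ε (WithLp.toLp 2 (θ₁, θ₂)) (X, s)
      (WithLp.toLp 2 (y, 0)) := by
  rintro ⟨X', s'⟩
  refine forall_mem_toSplitProblem_Q_iff.2 fun y' hy' => ?_
  rw [toSplitProblem_augLagrangian, toSplitProblem_augLagrangian]
  have hbdd : BddBelow (D.penalizedValues l θ₁ θ₂) := by
    refine ⟨0, ?_⟩
    rintro _ ⟨X₀, s₀, y₀, -, rfl⟩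
    rw [← toSplitProblem_augLagrangian]
    exact add_nonneg (mul_nonneg hl (toSplitProblem_f_nonneg hμ₁ hμ₂ _)) (by positivity)
  have hinf := csInf_le hbdd ⟨X', s', y', hy', rfl⟩
  exact h.trans (by gcongr)

/-- The factor `2` arises because the product carries the sup norm. -/
theorem penalized_le_of_mem_partialSubdiff
    {G : Matrix (Fin m) (Fin n) ℝ × EuclideanSpace ℝ (Fin p)}
    (hG : G ∈ D.partialSubdiff l θ₁ θ₂ X s y) (hτ : √(frobNorm G.1 ^ 2 + ‖G.2‖ ^ 2) ≤ τ)
    (v : Matrix (Fin m) (Fin n) ℝ × EuclideanSpace ℝ (Fin p)) :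
    D.penalized l θ₁ θ₂ X s y ≤ D.penalized l θ₁ θ₂ v.1 v.2 y + 2 * τ * ‖v - (X, s)‖ := by
  have hG₁ : frobNorm G.1 ≤ τ :=
    (Real.le_sqrt_of_sq_le (le_add_of_nonneg_right (sq_nonneg _))).trans hτ
  have hG₂ : ‖G.2‖ ≤ τ :=
    (Real.le_sqrt_of_sq_le (le_add_of_nonneg_left (sq_nonneg _))).trans hτ
  have hτ₀ : 0 ≤ τ := (norm_nonneg _).trans hG₂
  have hX : -(τ * ‖v - (X, s)‖) ≤ frobInner G.1 (v.1 - X) := by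
    refine (neg_le_neg ?_).trans (neg_abs_le _)
    calc |frobInner G.1 (v.1 - X)| ≤ frobNorm G.1 * ‖v.1 - X‖ := by
          rw [← frobNorm_eq_norm]
          exact abs_frobInner_le _ _
      _ ≤ τ * ‖v - (X, s)‖ := by gcongr; exact norm_fst_le (v - (X, s))
  have hs : -(τ * ‖v - (X, s)‖) ≤ inner ℝ G.2 (v.2 - s) := by
    refine (neg_le_neg ?_).trans (neg_abs_le _)
    calc |inner ℝ G.2 (v.2 - s)| ≤ ‖G.2‖ * ‖v.2 - s‖ := abs_real_inner_le_norm _ _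
      _ ≤ τ * ‖v - (X, s)‖ := by gcongr; exact norm_snd_le (v - (X, s))
  linarith [hG v.1 v.2]

theorem StopB.isApproxStationary [Fact (1 ≤ D.γ)] (h : D.StopB l τ ξ η θ₁ θ₂ X s y) :
    D.toSplitProblem.IsApproxStationary l (2 * τ) ξ (WithLp.toLp 2 (θ₁, θ₂)) (X, s)
      (WithLp.toLp 2 (y, 0)) := by
  obtain ⟨⟨G, hG, hτ⟩, hξ, -⟩ := h
  refine ⟨fun v => ?_, forall_mem_toSplitProblem_Q_iff.2 fun y' hy' => ?_⟩
  · rw [toSplitProblem_augLagrangian, toSplitProblem_augLagrangian]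
    exact penalized_le_of_mem_partialSubdiff hG hτ v
  · rw [toSplitProblem_residual, WithLp.prod_inner_apply]
    simpa [gradY_eq] using inner_sub_le_of_mul_dualNorm_add_inner_le hξ hy'

end Stopping

namespace IsFALC

variable {lam ε τ ξ : ℕ → ℝ} {X : ℕ → Matrix (Fin m) (Fin n) ℝ}
  {s : ℕ → EuclideanSpace ℝ (Fin p)} {y : ℕ → EuclideanSpace ℝ (Fin q)}
  {θ₁ : ℕ → EuclideanSpace ℝ (Fin q)} {θ₂ : ℕ → EuclideanSpace ℝ (Fin p)}

theorem isRun [Fact (1 ≤ D.α)] [Fact (1 ≤ D.β)] [Fact (1 ≤ D.γ)] (hμ₁ : 0 ≤ D.μ₁)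
    (hμ₂ : 0 ≤ D.μ₂) (hpar : IsAdmissibleSchedule lam ε τ ξ)
    (hrun : D.IsFALC lam ε τ ξ X s y θ₁ θ₂) :
    D.toSplitProblem.IsRun lam ε (fun k => 2 * τ k) ξ (fun k => (X k, s k))
      (fun k => WithLp.toLp 2 (y k, 0)) (fun k => WithLp.toLp 2 (θ₁ k, θ₂ k)) where
  y_mem k hk := ⟨hrun.y_mem k hk, rfl⟩
  accept k hk := (hrun.accept k hk).imp (StopA.isApproxMinimizer hμ₁ hμ₂ (hpar.lam_pos k hk).le)
    StopB.isApproxStationary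
  multiplier_succ k hk := by
    rw [toSplitProblem_residual, hrun.theta₁_succ k hk, hrun.theta₂_succ k hk]
    rfl

theorem isBoundedUnder_norm_multiplier [Fact (1 ≤ D.α)] [Fact (1 ≤ D.β)] [Fact (1 ≤ D.γ)]
    (hμ₁ : 0 ≤ D.μ₁) (hμ₂ : 0 ≤ D.μ₂) (hA : Function.Surjective D.A)
    (hpar : IsAdmissibleSchedule lam ε τ ξ) (hrun : D.IsFALC lam ε τ ξ X s y θ₁ θ₂) :
    IsBoundedUnder (· ≤ ·) atTop fun k => ‖WithLp.toLp 2 (θ₁ k, θ₂ k)‖ := by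
  obtain ⟨L, hL⟩ := exists_lipschitzWith_toSplitProblem_f hμ₁ hμ₂
  exact (hrun.isRun hμ₁ hμ₂ hpar).isBoundedUnder_norm_multiplier (hpar.const_mul_τ 2) hL
    (surjective_toSplitProblem_T hA)

theorem exists_frobNorm_le [Fact (1 ≤ D.α)] [Fact (1 ≤ D.β)] [Fact (1 ≤ D.γ)]
    (hμ₁ : 0 ≤ D.μ₁) (hμ₂ : 0 ≤ D.μ₂) (hA : Function.Surjective D.A)
    (hpar : IsAdmissibleSchedule lam ε τ ξ) (hrun : D.IsFALC lam ε τ ξ X s y θ₁ θ₂)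
    (h : 0 < D.μ₁ ∨ 0 < D.μ₂ ∧ Disjoint (LinearMap.ker D.A) (LinearMap.ker D.C)) :
    ∃ R : ℝ, ∀ k, frobNorm (X k) ≤ R := by
  have hfeas : D.toSplitProblem.feasible.Nonempty := by
    obtain ⟨v, hv⟩ := surjective_toSplitProblem_T hA
      (D.toSplitProblem.c - WithLp.toLp 2 (y 1, 0))
    refine ⟨v, ?_⟩
    rw [SplitProblem.feasible, mem_ofPred_eq, hv, sub_sub_cancel]
    exact ⟨hrun.y_mem 1 le_rfl, rfl⟩
  obtain ⟨a, ha, hcoercive⟩ := exists_norm_le_mul_toSplitProblem hμ₁ hμ₂ h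
  obtain ⟨R, hR⟩ := ((hrun.isRun hμ₁ hμ₂ hpar).isBoundedUnder_norm (hpar.const_mul_τ 2)
    (convexOn_toSplitProblem_f hμ₁ hμ₂)
    (hrun.isBoundedUnder_norm_multiplier hμ₁ hμ₂ hA hpar) hfeas isBounded_toSplitProblem_Q ha
    hcoercive).bddAbove_range
  refine ⟨R, fun k => ?_⟩
  rw [frobNorm_eq_norm]
  exact (norm_fst_le (X k, s k)).trans (hR ⟨k, rfl⟩)

theorem isOptimal_of_tendsto [Fact (1 ≤ D.α)] [Fact (1 ≤ D.β)] [Fact (1 ≤ D.γ)]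
    (hμ₁ : 0 ≤ D.μ₁) (hμ₂ : 0 ≤ D.μ₂) (hA : Function.Surjective D.A)
    (hpar : IsAdmissibleSchedule lam ε τ ξ) (hrun : D.IsFALC lam ε τ ξ X s y θ₁ θ₂)
    {φ : ℕ → ℕ} (hφ : Tendsto φ atTop atTop) {Xbar : Matrix (Fin m) (Fin n) ℝ}
    (hX : Tendsto (fun j => X (φ j)) atTop (𝓝 Xbar)) : D.IsOptimal Xbar := by
  have hrun' := hrun.isRun hμ₁ hμ₂ hpar
  have hpar' := hpar.const_mul_τ 2
  have hθ := hrun.isBoundedUnder_norm_multiplier hμ₁ hμ₂ hA hpar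
  obtain ⟨L, hL⟩ := exists_lipschitzWith_toSplitProblem_f hμ₁ hμ₂
  have hslack : Tendsto (fun j => D.C (X (φ j)) + s (φ j) - D.d) atTop (𝓝 0) := by
    have hsnd := ((WithLp.continuous_snd 2 _ _).tendsto _).comp
      ((hrun'.tendsto_residual hpar' hθ).comp hφ)
    simp only [Function.comp_def, toSplitProblem_residual] at hsnd
    exact hsnd
  have hs : Tendsto (fun j => s (φ j)) atTop (𝓝 (D.d - D.C Xbar)) := by
    have hC := (D.C.continuous_of_finiteDimensional.tendsto Xbar).comp hX
    simpa using (hslack.add_const D.d).sub hC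
  obtain ⟨hmem, hmin⟩ := hrun'.feasible_and_isMinOn_of_tendsto hpar'
    (convexOn_toSplitProblem_f hμ₁ hμ₂) hL.continuous hθ isClosed_toSplitProblem_Q hφ
    (hX.prodMk_nhds hs)
  exact isOptimal_of_isMinOn hmem hmin

end IsFALC

end CompositeProblem

end FALC

theorem theorem1_general {m n p q : ℕ} (D : CompositeProblem m n p q)
    (hα : 1 ≤ D.α) (hβ : 1 ≤ D.β) (hγ : 1 ≤ D.γ) (hμ₁ : 0 ≤ D.μ₁) (hμ₂ : 0 ≤ D.μ₂)
    (hA : Function.Surjective D.A) {lam ε τ ξ : ℕ → ℝ}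
    (hpar : IsAdmissibleSchedule lam ε τ ξ) {X : ℕ → Matrix (Fin m) (Fin n) ℝ}
    {s : ℕ → EuclideanSpace ℝ (Fin p)} {y : ℕ → EuclideanSpace ℝ (Fin q)}
    {θ₁ : ℕ → EuclideanSpace ℝ (Fin q)} {θ₂ : ℕ → EuclideanSpace ℝ (Fin p)}
    (hrun : D.IsFALC lam ε τ ξ X s y θ₁ θ₂) :
    ((0 < D.μ₁ ∨ (0 < D.μ₂ ∧ Disjoint (LinearMap.ker D.A) (LinearMap.ker D.C))) →
      ∃ R : ℝ, ∀ k, frobNorm (X k) ≤ R) ∧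
    ∀ Xbar : Matrix (Fin m) (Fin n) ℝ,
      (∃ φ : ℕ → ℕ, StrictMono φ ∧ Tendsto (fun j => X (φ j)) atTop (𝓝 Xbar)) →
      D.IsOptimal Xbar := by
  have : Fact (1 ≤ D.α) := ⟨hα⟩
  have : Fact (1 ≤ D.β) := ⟨hβ⟩
  have : Fact (1 ≤ D.γ) := ⟨hγ⟩
  exact ⟨hrun.exists_frobNorm_le hμ₁ hμ₂ hA hpar,
    fun _ ⟨_, hφ, hX⟩ => hrun.isOptimal_of_tendsto hμ₁ hμ₂ hA hpar hφ.tendsto_atTop hX⟩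

theorem one_le_of_eq_one_or_two_or_top {r : ℝ≥0∞} (hr : r = 1 ∨ r = 2 ∨ r = ∞) : 1 ≤ r := by
  rcases hr with rfl | rfl | rfl <;> simp

theorem theorem1 {m n p q : ℕ} (D : CompositeProblem m n p q)
    (hα : D.α = 1 ∨ D.α = 2 ∨ D.α = ∞)
    (hβ : D.β = 1 ∨ D.β = 2 ∨ D.β = ∞)
    (hγ : D.γ = 1 ∨ D.γ = 2 ∨ D.γ = ∞)
    (hμ₁ : 0 ≤ D.μ₁) (hμ₂ : 0 ≤ D.μ₂) (hρ : 0 ≤ D.ρ)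
    (hA : Function.Surjective D.A)
    (lam ε τ ξ : ℕ → ℝ)
    (hlam_pos : ∀ k, 1 ≤ k → 0 < lam k)
    (hlam : DecreasesToZero lam)
    (hε : DecreasesToZero ε)
    (hεlam : ∃ B : ℝ, 0 < B ∧ ∀ k, 1 ≤ k → ε k / lam k ^ 2 ≤ B)
    (hτ : DecreasesToZero τ)
    (hξ : DecreasesToZero ξ)
    (hτlam : Tendsto (fun k => τ k / lam k) atTop (𝓝 0))
    (hξlam : Tendsto (fun k => ξ k / lam k) atTop (𝓝 0))
    (X : ℕ → Matrix (Fin m) (Fin n) ℝ)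
    (s : ℕ → EuclideanSpace ℝ (Fin p)) (y : ℕ → EuclideanSpace ℝ (Fin q))
    (θ₁ : ℕ → EuclideanSpace ℝ (Fin q)) (θ₂ : ℕ → EuclideanSpace ℝ (Fin p))
    (hrun : D.IsFALC lam ε τ ξ X s y θ₁ θ₂) :
    ((0 < D.μ₁ ∨ (0 < D.μ₂ ∧ Function.Injective D.C)) →
      ∃ R : ℝ, ∀ k, frobNorm (X k) ≤ R) ∧
    ∀ Xbar : Matrix (Fin m) (Fin n) ℝ,
      (∃ φ : ℕ → ℕ, StrictMono φ ∧ Tendsto (fun j => X (φ j)) atTop (𝓝 Xbar)) →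
      D.IsOptimal Xbar := by
  obtain ⟨B, -, hB⟩ := hεlam
  exact (theorem1_general D (one_le_of_eq_one_or_two_or_top hα)
    (one_le_of_eq_one_or_two_or_top hβ) (one_le_of_eq_one_or_two_or_top hγ) hμ₁ hμ₂ hA
    ⟨hlam_pos, hlam.2, ⟨B, hB⟩, hτlam, hξlam⟩ hrun).imp_left fun hbounded h =>
      hbounded (h.imp_right (And.imp_right fun hC => by simp [LinearMap.ker_eq_bot.2 hC]))
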